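/- Let $(\breve N,\breve g)$ be a (smooth, finite-dimensional) semi-Riemannian manifold with Levi-Civita connection $\breve\nabla$, and let $\breve P$ be a locally Golden structure on it: a smooth $(1,1)$-tensor field with $\breve P^2=\breve P+I$, $\breve g(\breve PX,Y)=\breve g(X,\breve PY)$ and $\breve\nabla_X(\breve PY)=\breve P\breve\nabla_XY$. Let $\acute N$ be a lightlike submanifold immersed in $\breve N$: the radical distribution $\mathrm{Rad}\,T\acute N=T\acute N\cap T\acute N^{\perp}$ has constant rank $r\ge 1$, and smooth bundles $S(T\acute N)$ (the screen distribution), $S(T\acute N^\perp)$ and $ltr(T\acute N)$ are chosen such that $$T\acute N=\mathrm{Rad}\,T\acute N\perp S(T\acute N),\qquad T\acute N^\perp=\mathrm{Rad}\,T\acute N\perp S(T\acute N^\perp),$$ $$T\breve N|_{\acute N}=S(T\acute N)\perp[\mathrm{Rad}\,T\acute N\oplus ltr(T\acute N)]\perp S(T\acute N^\perp);$$ it is not required that $\breve g$ vanish on $ltr(T\acute N)$. Suppose that $\acute N$ is radical transversal, that is, $\breve P(\mathrm{Rad}\,T\acute N)=ltr(T\acute N)$ and $\breve P(S(T\acute N))=S(T\acute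 N)$. For vector fields $U,W$ on $\acute N$ let $h^l(U,W)$ be the $ltr(T\acute N)$-component of $\breve\nabla_UW$ in the decomposition $T\breve N|_{\acute N}=T\acute N\oplus ltr(T\acute N)\oplus S(T\acute N^\perp)$, and let $SW=\breve PTW$, where $T$ is the projection of $T\acute N=S(T\acute N)\perp\mathrm{Rad}\,T\acute N$ onto $S(T\acute N)$. Then the distribution $S(T\acute N)$ is integrable, i.e. $[U,W]\in\Gamma(S(T\acute N))$ for all $U,W\in\Gamma(S(T\acute N))$, if and only if $$h^l(U,SW)=h^l(W,SU)\qquad\text{for all } W,U\in\Gamma(S(T\acute N)).$$ -/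

import Mathlib

open scoped Manifold ContDiff

namespace GoldenLightlike

noncomputable section

/-! ### Semi-Riemannian metrics, Levi-Civita connections, Golden structures

Manifolds are smooth, without boundary, modelled on a finite-dimensional real vector space.
The ambient manifold is `N` (modelled on `E`), the submanifold is `M` (modelled on `F`). -/

/-- `q` is the index of the bilinear form `b`: the largest dimension of a subspace on which `b`
is negative definite. -/
def IsIndex {V : Type*} [AddCommGroup V] [Module ℝ V] (b : V → V → ℝ) (q : ℕ) : Prop :=
  IsGreatest {k : ℕ | ∃ D : Submodule ℝ V, Module.finrank ℝ D = k ∧ ∀ v ∈ D, v ≠ 0 → b v v < 0} q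

/-- A semi-Riemannian metric: a smooth symmetric nondegenerate `(0,2)`-tensor field of constant
index. -/
structure SemiRiemannianMetric (E : Type*) [NormedAddCommGroup E] [NormedSpace ℝ E]
    (N : Type*) [TopologicalSpace N] [ChartedSpace E N] [IsManifold 𝓘(ℝ, E) ∞ N] where
  val (p : N) : TangentSpace 𝓘(ℝ, E) p →L[ℝ] TangentSpace 𝓘(ℝ, E) p →L[ℝ] ℝ
  symm (p : N) (v w : TangentSpace 𝓘(ℝ, E) p) : val p v w = val p w v
  nondegenerate (p : N) (v : TangentSpace 𝓘(ℝ, E) p) (hv : ∀ w, val p v w = 0) : v = 0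
  smooth : ContMDiff 𝓘(ℝ, E) (𝓘(ℝ, E).prod 𝓘(ℝ, E →L[ℝ] E →L[ℝ] ℝ)) ∞
    (fun p ↦ Bundle.TotalSpace.mk' (E →L[ℝ] E →L[ℝ] ℝ)
      (E := fun p : N ↦ TangentSpace 𝓘(ℝ, E) p →L[ℝ] TangentSpace 𝓘(ℝ, E) p →L[ℝ] ℝ) p (val p))
  index_const : ∃ q : ℕ, ∀ p : N, IsIndex (fun v w ↦ val p v w) q

/-- A vector field `X`, given as a map `p ↦ X p ∈ T_p N`, is differentiable at `p`. -/
def DiffAt (E : Type*) [NormedAddCommGroup E] [NormedSpace ℝ E]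
    {N : Type*} [TopologicalSpace N] [ChartedSpace E N] [IsManifold 𝓘(ℝ, E) ∞ N]
    (X : ∀ p : N, TangentSpace 𝓘(ℝ, E) p) (p : N) : Prop :=
  MDifferentiableAt 𝓘(ℝ, E) 𝓘(ℝ, E).tangent
    (fun q ↦ (⟨q, X q⟩ : TangentBundle 𝓘(ℝ, E) N)) p

section Ambient

variable {E : Type*} [NormedAddCommGroup E] [NormedSpace ℝ E]
  {N : Type*} [TopologicalSpace N] [ChartedSpace E N] [IsManifold 𝓘(ℝ, E) ∞ N]

/-- `nabla` is the Levi-Civita connection of `g`: the torsion-free metric connection.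
In Mathlib's notation `nabla Y p (X p)` is `(∇_X Y)(p)`. -/
structure IsLeviCivita (g : SemiRiemannianMetric E N)
    (nabla : CovariantDerivative 𝓘(ℝ, E) E (TangentSpace 𝓘(ℝ, E) : N → Type _)) : Prop where
  torsion_free : ∀ (X Y : ∀ p : N, TangentSpace 𝓘(ℝ, E) p) (p : N), DiffAt E X p → DiffAt E Y p →
    nabla Y p (X p) - nabla X p (Y p) = VectorField.mlieBracket 𝓘(ℝ, E) X Y p
  metric : ∀ (Y Z : ∀ p : N, TangentSpace 𝓘(ℝ, E) p) (p : N) (v : TangentSpace 𝓘(ℝ, E) p),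
    DiffAt E Y p → DiffAt E Z p →
    (mfderiv 𝓘(ℝ, E) 𝓘(ℝ, ℝ) (fun q ↦ g.val q (Y q) (Z q)) p v : ℝ) =
      g.val p (nabla Y p v) (Z p) + g.val p (Y p) (nabla Z p v)

/-- A Golden structure on `(N, g)`: a smooth `(1,1)`-tensor field `P` with `P² = P + I` such that
`g` is `P`-compatible. -/
structure GoldenStructure (g : SemiRiemannianMetric E N) where
  P (p : N) : TangentSpace 𝓘(ℝ, E) p →L[ℝ] TangentSpace 𝓘(ℝ, E) p
  smooth : ContMDiff 𝓘(ℝ, E) (𝓘(ℝ, E).prod 𝓘(ℝ, E →L[ℝ] E)) ∞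
    (fun p ↦ Bundle.TotalSpace.mk' (E →L[ℝ] E)
      (E := fun p : N ↦ TangentSpace 𝓘(ℝ, E) p →L[ℝ] TangentSpace 𝓘(ℝ, E) p) p (P p))
  golden (p : N) (v : TangentSpace 𝓘(ℝ, E) p) : P p (P p v) = P p v + v
  compatible (p : N) (v w : TangentSpace 𝓘(ℝ, E) p) : g.val p (P p v) w = g.val p v (P p w)

/-- `P` is parallel: `∇_X (P Y) = P (∇_X Y)`. A Golden semi-Riemannian manifold with this property
for the Levi-Civita connection is locally Golden. -/
def GoldenStructure.IsParallel {g : SemiRiemannianMetric E N} (G : GoldenStructure g)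
    (nabla : CovariantDerivative 𝓘(ℝ, E) E (TangentSpace 𝓘(ℝ, E) : N → Type _)) : Prop :=
  ∀ (Y : ∀ p : N, TangentSpace 𝓘(ℝ, E) p) (p : N) (v : TangentSpace 𝓘(ℝ, E) p), DiffAt E Y p →
    nabla (fun q ↦ G.P q (Y q)) p v = G.P p (nabla Y p v)

end Ambient

section Submanifold

variable {E : Type*} [NormedAddCommGroup E] [NormedSpace ℝ E]
  {N : Type*} [TopologicalSpace N] [ChartedSpace E N] [IsManifold 𝓘(ℝ, E) ∞ N]
  {F : Type*} [NormedAddCommGroup F] [NormedSpace ℝ F]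
  {M : Type*} [TopologicalSpace M] [ChartedSpace F M] [IsManifold 𝓘(ℝ, F) ∞ M]

/-! ### Vector fields and subbundles along a map -/

/-- The differential `T_x M → T_{f x} N`. -/
def diff (f : M → N) (x : M) : TangentSpace 𝓘(ℝ, F) x →ₗ[ℝ] TangentSpace 𝓘(ℝ, E) (f x) :=
  (mfderiv 𝓘(ℝ, F) 𝓘(ℝ, E) f x).toLinearMap

/-- A family of subspaces `D x ≤ T_{f x} N` is a smooth subbundle of `f^* TN`: near every point
it has a frame consisting of smooth vector fields along `f`. -/
def IsSmoothSubbundleAlong (f : M → N)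
    (D : ∀ x : M, Submodule ℝ (TangentSpace 𝓘(ℝ, E) (f x))) : Prop :=
  ∀ x₀ : M, ∃ u : Set M, IsOpen u ∧ x₀ ∈ u ∧ ∃ (k : ℕ)
    (s : Fin k → ∀ x : M, TangentSpace 𝓘(ℝ, E) (f x)),
    (∀ i, ContMDiffOn 𝓘(ℝ, F) 𝓘(ℝ, E).tangent ∞
      (fun x ↦ (⟨f x, s i x⟩ : TangentBundle 𝓘(ℝ, E) N)) u) ∧
    ∀ x ∈ u, LinearIndependent ℝ (fun i ↦ s i x) ∧ Submodule.span ℝ (Set.range fun i ↦ s i x) = D x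

/-- `D` is a smooth distribution on `M`, that is, a smooth subbundle of `TM`. -/
def IsSmoothDistribution (D : ∀ x : M, Submodule ℝ (TangentSpace 𝓘(ℝ, F) x)) : Prop :=
  IsSmoothSubbundleAlong (E := F) (F := F) (fun x : M ↦ x) D

/-- `X ∈ Γ(D)`: `X` is a smooth vector field on `M` with values in `D`. -/
def IsSection (D : ∀ x : M, Submodule ℝ (TangentSpace 𝓘(ℝ, F) x))
    (X : ∀ x : M, TangentSpace 𝓘(ℝ, F) x) : Prop :=
  ContMDiff 𝓘(ℝ, F) 𝓘(ℝ, F).tangent ∞ (fun x ↦ (⟨x, X x⟩ : TangentBundle 𝓘(ℝ, F) M)) ∧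
    ∀ x, X x ∈ D x

/-- The distribution `D` is integrable: `[X, Y] ∈ Γ(D)` for all `X, Y ∈ Γ(D)`. -/
def IsIntegrable (D : ∀ x : M, Submodule ℝ (TangentSpace 𝓘(ℝ, F) x)) : Prop :=
  ∀ X Y : ∀ x : M, TangentSpace 𝓘(ℝ, F) x, IsSection D X → IsSection D Y →
    ∀ x, VectorField.mlieBracket 𝓘(ℝ, F) X Y x ∈ D x

/-- The covariant derivative `(∇_v V)(x) ∈ T_{f x} N` of a vector field `V` along `f`, for
`v ∈ T_x M` (the pullback connection). If `(e_i)` is the frame of `TN` near `f x` given by the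
trivialization at `f x` and `V y = ∑ᵢ Vⁱ(y) e_i(f y)`, it is
`∑ᵢ dVⁱ(v) e_i(f x) + ∑ᵢ Vⁱ(x) (∇_{df(v)} e_i)(f x)`. -/
def covAlong (nabla : CovariantDerivative 𝓘(ℝ, E) E (TangentSpace 𝓘(ℝ, E) : N → Type _))
    (f : M → N) (V : ∀ x : M, TangentSpace 𝓘(ℝ, E) (f x)) (x : M)
    (v : TangentSpace 𝓘(ℝ, F) x) : TangentSpace 𝓘(ℝ, E) (f x) :=
  letI t := trivializationAt E (TangentSpace 𝓘(ℝ, E) : N → Type _) (f x)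
  letI coord : M → E := fun y ↦ (t ⟨f y, V y⟩).2
  t.symm (f x) (mfderiv 𝓘(ℝ, F) 𝓘(ℝ, E) coord x v : E) +
    nabla (fun p ↦ t.symm p (coord x)) (f x) (diff f x v)

/-! ### Lightlike submanifolds -/

/-- `T_x M^⊥`, the vectors of `T_{f x} N` orthogonal to `T_x M`. -/
def normalSpace (g : SemiRiemannianMetric E N) (f : M → N) (x : M) :
    Submodule ℝ (TangentSpace 𝓘(ℝ, E) (f x)) where
  carrier := {u | ∀ v : TangentSpace 𝓘(ℝ, F) x, g.val (f x) u (diff f x v) = 0}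
  add_mem' := by
    intro a b ha hb v
    have h1 := ha v
    have h2 := hb v
    simp only [map_add, add_apply]
    rw [h1, h2, add_zero]
  zero_mem' := by
    intro v
    simp
  smul_mem' := by
    intro c a ha v
    have h1 := ha v
    simp only [map_smul, smul_apply]
    rw [h1, smul_zero]

/-- `Rad T_x M = T_x M ∩ T_x M^⊥`, as a subspace of `T_x M`. -/
def radical (g : SemiRiemannianMetric E N) (f : M → N) (x : M) :
    Submodule ℝ (TangentSpace 𝓘(ℝ, F) x) :=
  (normalSpace (F := F) g f x).comap (diff f x)

/-- The structure of a lightlike submanifold `(M, g, S(TM), S(TM^⊥))` on a map `f : M → N`,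
together with its lightlike transversal bundle `ltr(TM)`, so that
`TM = Rad TM ⊥ S(TM)`, `TM^⊥ = Rad TM ⊥ S(TM^⊥)` and
`TN|_M = S(TM) ⊥ [Rad TM ⊕ ltr(TM)] ⊥ S(TM^⊥)`.
No further condition (such as `g` vanishing on `ltr(TM)`) is imposed on `ltr(TM)`. -/
structure LightlikeSubmanifold (g : SemiRiemannianMetric E N) (f : M → N) where
  smooth : ContMDiff 𝓘(ℝ, F) 𝓘(ℝ, E) ∞ f
  immersion : ∀ x, Function.Injective (diff (E := E) (F := F) f x)
  /-- the rank of the radical distribution -/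
  r : ℕ
  one_le_r : 1 ≤ r
  finrank_radical : ∀ x, Module.finrank ℝ (radical (F := F) g f x) = r
  /-- the screen distribution `S(TM)` -/
  screen : ∀ x : M, Submodule ℝ (TangentSpace 𝓘(ℝ, F) x)
  screen_smooth : IsSmoothDistribution screen
  screen_isCompl : ∀ x, IsCompl (screen x) (radical g f x)
  /-- the screen transversal bundle `S(TM^⊥)` -/
  strans : ∀ x : M, Submodule ℝ (TangentSpace 𝓘(ℝ, E) (f x))
  strans_smooth : IsSmoothSubbundleAlong (F := F) f strans
  strans_disjoint : ∀ x, Disjoint (strans x) ((radical (F := F) g f x).map (diff f x))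
  strans_sup : ∀ x, strans x ⊔ (radical (F := F) g f x).map (diff f x) = normalSpace (F := F) g f x
  /-- the lightlike transversal bundle `ltr(TM)` -/
  ltr : ∀ x : M, Submodule ℝ (TangentSpace 𝓘(ℝ, E) (f x))
  ltr_smooth : IsSmoothSubbundleAlong (F := F) f ltr
  ltr_orthogonal_screen : ∀ x, ∀ n ∈ ltr x, ∀ v ∈ screen x, g.val (f x) n (diff f x v) = 0
  ltr_orthogonal_strans : ∀ x, ∀ n ∈ ltr x, ∀ z ∈ strans x, g.val (f x) n z = 0
  ltr_isCompl : ∀ x, IsCompl (LinearMap.range (diff (F := F) f x) ⊔ strans x) (ltr x)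

namespace LightlikeSubmanifold

variable {g : SemiRiemannianMetric E N} {f : M → N}

theorem disjoint_range_strans (L : LightlikeSubmanifold (F := F) g f) (x : M) :
    Disjoint (LinearMap.range (diff (F := F) f x)) (L.strans x) := by
  rw [Submodule.disjoint_def]
  rintro _ ⟨v, rfl⟩ hs
  have hn : diff f x v ∈ normalSpace (F := F) g f x := by
    rw [← L.strans_sup x]
    exact Submodule.mem_sup_left hs
  exact (Submodule.disjoint_def.mp (L.strans_disjoint x)) _ hs ⟨v, hn, rfl⟩

/-- `TN|_M = TM ⊕ tr(TM)` with `tr(TM) = ltr(TM) ⊥ S(TM^⊥)`. -/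
theorem isCompl_range_tr (L : LightlikeSubmanifold (F := F) g f) (x : M) :
    IsCompl (LinearMap.range (diff (F := F) f x)) (L.strans x ⊔ L.ltr x) where
  disjoint := (L.disjoint_range_strans x).disjoint_sup_right_of_disjoint_sup_left
    (L.ltr_isCompl x).disjoint
  codisjoint := by
    rw [codisjoint_iff, ← sup_assoc]
    exact (L.ltr_isCompl x).sup_eq_top

/-- The tangential component `T_{f x} N → T_x M` along `tr(TM)`. -/
def tangentialPart (L : LightlikeSubmanifold (F := F) g f) (x : M) :
    TangentSpace 𝓘(ℝ, E) (f x) →ₗ[ℝ] TangentSpace 𝓘(ℝ, F) x :=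
  (LinearEquiv.ofInjective (diff f x) (L.immersion x)).symm.toLinearMap ∘ₗ
    Submodule.projectionOnto _ _ (L.isCompl_range_tr x)

/-- The `ltr(TM)`-component of a vector of `T_{f x} N = T_x M ⊕ S(TM^⊥) ⊕ ltr(TM)`. -/
def ltrPart (L : LightlikeSubmanifold (F := F) g f) (x : M) :
    TangentSpace 𝓘(ℝ, E) (f x) →ₗ[ℝ] L.ltr x :=
  Submodule.projectionOnto _ _ (L.ltr_isCompl x).symm

/-- The lightlike second fundamental form `h^l(U, W)` at `x`: the `ltr(TM)`-component in
the Gauss formula `∇̄_U W = ∇_U W + h^l(U, W) + h^s(U, W)`. -/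
def hl (L : LightlikeSubmanifold (F := F) g f)
    (nabla : CovariantDerivative 𝓘(ℝ, E) E (TangentSpace 𝓘(ℝ, E) : N → Type _))
    (U W : ∀ x : M, TangentSpace 𝓘(ℝ, F) x) (x : M) : L.ltr x :=
  L.ltrPart x (covAlong nabla f (fun y ↦ diff f y (W y)) x (U x))

/-- The projection `T` of `TM = S(TM) ⊥ Rad TM` onto `S(TM)`. -/
def screenProj (L : LightlikeSubmanifold (F := F) g f) (x : M) :
    TangentSpace 𝓘(ℝ, F) x →ₗ[ℝ] TangentSpace 𝓘(ℝ, F) x :=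
  (L.screen x).subtype ∘ₗ Submodule.projectionOnto _ _ (L.screen_isCompl x)

/-- `M` is a radical transversal lightlike submanifold: `P (Rad TM) = ltr(TM)` and
`P (S(TM)) = S(TM)`. -/
structure IsRadicalTransversal (L : LightlikeSubmanifold (F := F) g f) (G : GoldenStructure g) :
    Prop where
  map_radical : ∀ x, ((radical (F := F) g f x).map (diff f x)).map (G.P (f x)).toLinearMap = L.ltr x
  map_screen : ∀ x,
    ((L.screen x).map (diff f x)).map (G.P (f x)).toLinearMap = (L.screen x).map (diff f x)

/-- The vector field `S W = P T W` on `M`, where `T` is the projection onto `S(TM)`; it is read as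
a vector field on `M` by taking its tangential component, and `diff_goldenS` says that nothing is
lost if `M` is radical transversal. -/
def goldenS (L : LightlikeSubmanifold (F := F) g f) (G : GoldenStructure g)
    (W : ∀ x : M, TangentSpace 𝓘(ℝ, F) x) (x : M) : TangentSpace 𝓘(ℝ, F) x :=
  L.tangentialPart x (G.P (f x) (diff f x (L.screenProj x (W x))))

theorem diff_goldenS (L : LightlikeSubmanifold (F := F) g f) (G : GoldenStructure g)
    (h : L.IsRadicalTransversal G) (W : ∀ x : M, TangentSpace 𝓘(ℝ, F) x) (x : M) :
    diff f x (L.goldenS G W x) = G.P (f x) (diff f x (L.screenProj x (W x))) := by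
  have hmem : G.P (f x) (diff f x (L.screenProj x (W x))) ∈ (L.screen x).map (diff f x) := by
    rw [← h.map_screen x]
    exact ⟨_, ⟨_, Subtype.coe_prop _, rfl⟩, rfl⟩
  obtain ⟨v, -, hv⟩ := hmem
  have hv' : L.tangentialPart x (diff f x v) = v := by
    have h1 := Submodule.projectionOnto_apply_left (L.isCompl_range_tr x)
      ⟨diff f x v, LinearMap.mem_range_self _ v⟩
    simp only [tangentialPart, LinearMap.comp_apply, LinearEquiv.coe_coe]
    rw [LinearEquiv.symm_apply_eq]
    exact h1
  rw [goldenS, ← hv, hv']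

end LightlikeSubmanifold

end Submanifold

end

end GoldenLightlike

/-! Let `U`, `W` be sections of the screen. There `T` is the identity, so `S W = P W`, and since `P`
is parallel the derivative of `S W` along `U` is `P` applied to the derivative of `W` along `U`
(`covAlong_parallel`, `hl_goldenS`). Torsion-freeness turns the antisymmetrised derivative into the
bracket (`covAlong_sub_covAlong`), so `h^l(U, SW) - h^l(W, SU)` is the `ltr`-component of `P (df [U,
W])`.

Split a tangent vector as `s + r` with `s` in the screen and `r` radical. Then `P s` is tangent and
has no `ltr`-component, while `P r` lies in `ltr`. As `P² = P + I` makes `P` injective, the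
`ltr`-component vanishes exactly when `r = 0` (`ltrPart_P_diff_eq_zero_iff`). Both directions
follow, point by point.

Most of the work is to carry the two properties of `nabla` over to `covAlong`, which is defined by
coordinates in a trivialization: differentiate the coordinates, then add `nabla` of the field with
frozen coordinates. -/

namespace GoldenLightlike

open Topology Bundle

/-! ### Covariant derivatives in a local trivialization -/

section LocalFormula

variable {E : Type*} [NormedAddCommGroup E] [NormedSpace ℝ E]
  {N : Type*} [TopologicalSpace N] [ChartedSpace E N] [IsManifold 𝓘(ℝ, E) ∞ N]

/-- The vector field with coordinate representation `φ` in the trivialization at `p₀`. -/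
noncomputable def coordField (p₀ : N) (φ : N → E) (q : N) : TangentSpace 𝓘(ℝ, E) q :=
  (trivializationAt E (TangentSpace 𝓘(ℝ, E) : N → Type _) p₀).symmL ℝ q (φ q)

theorem eventually_mem_baseSet (p₀ : N) :
    ∀ᶠ q in 𝓝 p₀, q ∈ (trivializationAt E (TangentSpace 𝓘(ℝ, E) : N → Type _) p₀).baseSet :=
  (trivializationAt E (TangentSpace 𝓘(ℝ, E) : N → Type _) p₀).open_baseSet.mem_nhds
    (FiberBundle.mem_baseSet_trivializationAt' p₀)

theorem diffAt_coordField {p₀ : N} {φ : N → E}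
    (hφ : MDifferentiableAt 𝓘(ℝ, E) 𝓘(ℝ, E) φ p₀) : DiffAt E (coordField p₀ φ) p₀ := by
  refine (mdifferentiableAt_section ..).2 (hφ.congr_of_eventuallyEq ?_)
  filter_upwards [eventually_mem_baseSet (E := E) p₀] with q hq
  rw [coordField, Trivialization.symmL_apply _ hq, Trivialization.apply_mk_symm _ hq]

theorem nabla_congr
    (nabla : CovariantDerivative 𝓘(ℝ, E) E (TangentSpace 𝓘(ℝ, E) : N → Type _))
    {X Y : ∀ p : N, TangentSpace 𝓘(ℝ, E) p} {p : N} (hX : DiffAt E X p) (hY : DiffAt E Y p)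
    (h : ∀ᶠ q in 𝓝 p, X q = Y q) : nabla X p = nabla Y p :=
  nabla.isCovariantDerivativeOnUniv.congr_of_eventuallyEq hX hY Filter.univ_mem h

theorem nabla_sum
    (nabla : CovariantDerivative 𝓘(ℝ, E) E (TangentSpace 𝓘(ℝ, E) : N → Type _))
    {ι : Type*} (s : Finset ι) (X : ι → ∀ p : N, TangentSpace 𝓘(ℝ, E) p) (p : N)
    (hX : ∀ i, DiffAt E (X i) p) :
    nabla (∑ i ∈ s, X i) p = ∑ i ∈ s, nabla (X i) p := by
  classical
  suffices h : DiffAt E (∑ i ∈ s, X i) p ∧ nabla (∑ i ∈ s, X i) p = ∑ i ∈ s, nabla (X i) p from h.2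
  induction s using Finset.induction_on with
  | empty =>
    simp only [Finset.sum_empty]
    exact ⟨mdifferentiableAt_zeroSection .., nabla.isCovariantDerivativeOnUniv.zero⟩
  | insert a s ha ih =>
    rw [Finset.sum_insert ha, Finset.sum_insert ha, ← ih.2]
    exact ⟨mdifferentiableAt_add_section (hX a) ih.1,
      nabla.isCovariantDerivativeOnUniv.add (hX a) ih.1⟩

/-- Coordinate formula for a covariant derivative: it differentiates the coordinates and adds the
derivative of the field with frozen coordinates. -/
theorem nabla_coordField [FiniteDimensional ℝ E]
    (nabla : CovariantDerivative 𝓘(ℝ, E) E (TangentSpace 𝓘(ℝ, E) : N → Type _))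
    {p₀ : N} {φ : N → E} (hφ : MDifferentiableAt 𝓘(ℝ, E) 𝓘(ℝ, E) φ p₀)
    (w : TangentSpace 𝓘(ℝ, E) p₀) :
    nabla (coordField p₀ φ) p₀ w =
      (trivializationAt E (TangentSpace 𝓘(ℝ, E) : N → Type _) p₀).symmL ℝ p₀
        (mvfderiv 𝓘(ℝ, E) φ p₀ w) +
      nabla (coordField p₀ fun _ ↦ φ p₀) p₀ w := by
  set b := Module.finBasis ℝ E
  let l (i : Fin (Module.finrank ℝ E)) : E →L[ℝ] ℝ := LinearMap.toContinuousLinearMap (b.coord i)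
  have hl (e : E) : ∑ i, l i e • b i = e := b.sum_equivFun e
  -- The Leibniz rule concerns scalar multiples of a section, so the field is expanded in the frame
  -- induced by a basis of `E`.
  have hs (ψ : N → E) : coordField p₀ ψ =
      ∑ i, (fun q ↦ l i (ψ q)) • coordField p₀ (fun _ ↦ b i) := by
    funext q
    simp only [Finset.sum_apply, Pi.smul_apply', coordField, ← map_smul, ← map_sum]
    rw [hl]
  have hb (i) : DiffAt E (coordField p₀ fun _ ↦ b i) p₀ := diffAt_coordField mdifferentiableAt_const
  have hφi (i) : HasMFDerivAt 𝓘(ℝ, E) 𝓘(ℝ, ℝ) (fun q ↦ l i (φ q)) p₀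
      ((l i).comp (mfderiv 𝓘(ℝ, E) 𝓘(ℝ, E) φ p₀)) :=
    HasMFDerivAt.comp p₀ (l i).hasMFDerivAt hφ.hasMFDerivAt
  have hc (i : Fin (Module.finrank ℝ E)) : HasMFDerivAt 𝓘(ℝ, E) 𝓘(ℝ, ℝ) (fun _ : N ↦ l i (φ p₀)) p₀ 0 :=
    hasMFDerivAt_const ..
  rw [hs φ, hs fun _ ↦ φ p₀, nabla_sum _ _ _ _ fun i ↦
    MDifferentiableAt.smul_section (hφi i).mdifferentiableAt (hb i), nabla_sum _ _ _ _ fun i ↦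
    MDifferentiableAt.smul_section (hc i).mdifferentiableAt (hb i)]
  have h1 (i) : nabla ((fun q ↦ l i (φ q)) • coordField p₀ (fun _ ↦ b i)) p₀ w =
      l i (mvfderiv 𝓘(ℝ, E) φ p₀ w) • coordField p₀ (fun _ ↦ b i) p₀ +
      l i (φ p₀) • nabla (coordField p₀ (fun _ ↦ b i)) p₀ w := by
    rw [nabla.isCovariantDerivativeOnUniv.leibniz (hb i) (hφi i).mdifferentiableAt, add_comm,
      mvfderiv, (hφi i).mfderiv]
    rfl
  have h2 (i : Fin (Module.finrank ℝ E)) : nabla ((fun _ : N ↦ l i (φ p₀)) • coordField p₀ (fun _ ↦ b i)) p₀ w =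
      l i (φ p₀) • nabla (coordField p₀ (fun _ ↦ b i)) p₀ w := by
    rw [nabla.isCovariantDerivativeOnUniv.leibniz (hb i) (hc i).mdifferentiableAt,
      mvfderiv, (hc i).mfderiv]
    simp
  rw [_root_.sum_apply, _root_.sum_apply]
  simp only [h1, h2, Finset.sum_add_distrib]
  congr 1
  simp only [coordField, ← map_smul, ← map_sum]
  exact congrArg _ (hl _)

end LocalFormula

/-! ### Parallel tensors and the derivative along a map -/

section Parallel

variable {E : Type*} [NormedAddCommGroup E] [NormedSpace ℝ E]
  {N : Type*} [TopologicalSpace N] [ChartedSpace E N] [IsManifold 𝓘(ℝ, E) ∞ N]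
  {F : Type*} [NormedAddCommGroup F] [NormedSpace ℝ F]
  {M : Type*} [TopologicalSpace M] [ChartedSpace F M]

/-- The product rule needed when `P`, read as a matrix-valued function, acts on the coordinates of a
field. In the chart at `x` it is the rule for normed spaces. -/
theorem mdifferentiableAt_clm_apply {A : M → E →L[ℝ] E} {c : M → E} {x : M}
    (hA : MDifferentiableAt 𝓘(ℝ, F) 𝓘(ℝ, E →L[ℝ] E) A x)
    (hc : MDifferentiableAt 𝓘(ℝ, F) 𝓘(ℝ, E) c x) :
    MDifferentiableAt 𝓘(ℝ, F) 𝓘(ℝ, E) (fun y ↦ A y (c y)) x ∧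
    ∀ v, mvfderiv 𝓘(ℝ, F) (fun y ↦ A y (c y)) x v =
      mvfderiv 𝓘(ℝ, F) A x v (c x) + A x (mvfderiv 𝓘(ℝ, F) c x v) := by
  let A' : F →L[ℝ] E →L[ℝ] E := mfderiv 𝓘(ℝ, F) 𝓘(ℝ, E →L[ℝ] E) A x
  let c' : F →L[ℝ] E := mfderiv 𝓘(ℝ, F) 𝓘(ℝ, E) c x
  have h : HasMFDerivAt 𝓘(ℝ, F) 𝓘(ℝ, E) (fun y ↦ A y (c y)) x
      ((A x).comp c' + A'.flip (c x) : F →L[ℝ] E) := by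
    refine ⟨hA.continuousAt.clm_apply hc.continuousAt, ?_⟩
    have hA2 : HasFDerivWithinAt (fun z ↦ A ((extChartAt 𝓘(ℝ, F) x).symm z)) A'
        (Set.range 𝓘(ℝ, F)) (extChartAt 𝓘(ℝ, F) x x) := hA.hasMFDerivAt.2
    have hc2 : HasFDerivWithinAt (fun z ↦ c ((extChartAt 𝓘(ℝ, F) x).symm z)) c'
        (Set.range 𝓘(ℝ, F)) (extChartAt 𝓘(ℝ, F) x x) := hc.hasMFDerivAt.2
    have h2 := hA2.clm_apply hc2
    simp only [extChartAt_to_inv] at h2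
    exact h2
  refine ⟨h.mdifferentiableAt, fun v ↦ ?_⟩
  rw [mvfderiv, h.mfderiv, add_comm]
  rfl

theorem coordField_apply {p₀ q : N} (φ : N → E)
    (hq : q ∈ (trivializationAt E (TangentSpace 𝓘(ℝ, E) : N → Type _) p₀).baseSet) :
    coordField p₀ φ q =
      (trivializationAt E (TangentSpace 𝓘(ℝ, E) : N → Type _) p₀).symm q (φ q) :=
  Trivialization.symmL_apply _ hq _

/-- The coordinate representation at `x₀` of a vector field `V` along `f`. -/
noncomputable def coordAlong (f : M → N) (V : ∀ x : M, TangentSpace 𝓘(ℝ, E) (f x)) (x₀ y : M) : E :=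
  (trivializationAt E (TangentSpace 𝓘(ℝ, E) : N → Type _) (f x₀) ⟨f y, V y⟩).2

theorem covAlong_eq_coordField
    (nabla : CovariantDerivative 𝓘(ℝ, E) E (TangentSpace 𝓘(ℝ, E) : N → Type _))
    (f : M → N) (V : ∀ x : M, TangentSpace 𝓘(ℝ, E) (f x)) (x : M) (v : TangentSpace 𝓘(ℝ, F) x) :
    covAlong nabla f V x v =
      (trivializationAt E (TangentSpace 𝓘(ℝ, E) : N → Type _) (f x)).symmL ℝ (f x)
        (mvfderiv 𝓘(ℝ, F) (coordAlong f V x) x v) +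
      nabla (coordField (f x) fun _ ↦ coordAlong f V x x) (f x) (diff f x v) := by
  have h0 := FiberBundle.mem_baseSet_trivializationAt E
    (TangentSpace 𝓘(ℝ, E) : N → Type _) (f x)
  have hc : DiffAt E (coordField (f x) fun _ ↦ coordAlong f V x x) (f x) :=
    diffAt_coordField mdifferentiableAt_const
  -- `covAlong` uses `symm` and `coordField` uses `symmL`; agreement on the base set suffices
  -- because `nabla` is local.
  have he : ∀ᶠ q in 𝓝 (f x),
      (trivializationAt E (TangentSpace 𝓘(ℝ, E) : N → Type _) (f x)).symm q (coordAlong f V x x) =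
        coordField (f x) (fun _ ↦ coordAlong f V x x) q := by
    filter_upwards [eventually_mem_baseSet (E := E) (f x)] with q hq
    rw [coordField_apply _ hq]
  rw [← nabla_congr nabla (hc.congr_of_eventuallyEq (he.mono fun q hq ↦ congrArg (TotalSpace.mk q) hq)) hc he]
  exact congrArg (· + _) (Trivialization.symmL_apply (R := ℝ) _ h0 _).symm

/-- The witness is `inCoordinates` of `P`, and smoothness of a section of the Hom bundle is
smoothness of this function. -/
theorem GoldenStructure.exists_coord_endomorphism {g : SemiRiemannianMetric E N}
    (G : GoldenStructure g) (p₀ : N) :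
    ∃ A : N → E →L[ℝ] E, MDifferentiableAt 𝓘(ℝ, E) 𝓘(ℝ, E →L[ℝ] E) A p₀ ∧
      ∀ q ∈ (trivializationAt E (TangentSpace 𝓘(ℝ, E) : N → Type _) p₀).baseSet,
        (∀ v : TangentSpace 𝓘(ℝ, E) q,
          (trivializationAt E (TangentSpace 𝓘(ℝ, E) : N → Type _) p₀ ⟨q, G.P q v⟩).2 =
          A q (trivializationAt E (TangentSpace 𝓘(ℝ, E) : N → Type _) p₀ ⟨q, v⟩).2) ∧
        ∀ e : E, G.P q
          ((trivializationAt E (TangentSpace 𝓘(ℝ, E) : N → Type _) p₀).symmL ℝ q e) =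
          (trivializationAt E (TangentSpace 𝓘(ℝ, E) : N → Type _) p₀).symmL ℝ q (A q e) := by
  refine ⟨fun q ↦ ContinuousLinearMap.inCoordinates E (TangentSpace 𝓘(ℝ, E) : N → Type _) E
    (TangentSpace 𝓘(ℝ, E) : N → Type _) p₀ q p₀ q (G.P q),
    ((contMDiffAt_hom_bundle _).1 (G.smooth p₀)).2.mdifferentiableAt (by simp), fun q hq ↦
    ⟨fun v ↦ ?_, fun e ↦ ?_⟩⟩
  · change _ = (trivializationAt E (TangentSpace 𝓘(ℝ, E) : N → Type _) p₀).continuousLinearMapAt ℝ q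
      (G.P q ((trivializationAt E (TangentSpace 𝓘(ℝ, E) : N → Type _) p₀).symmL ℝ q _))
    rw [Trivialization.symmL_apply _ hq,
      Trivialization.symm_apply_apply_mk _ hq, Trivialization.continuousLinearMapAt_apply,
      Trivialization.coe_linearMapAt_of_mem _ hq]
  · exact (Trivialization.symmL_continuousLinearMapAt _ hq _).symm

/-- A parallel `(1,1)`-tensor field commutes with the covariant derivative along a map. -/
theorem covAlong_parallel [FiniteDimensional ℝ E] {g : SemiRiemannianMetric E N}
    {nabla : CovariantDerivative 𝓘(ℝ, E) E (TangentSpace 𝓘(ℝ, E) : N → Type _)}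
    (G : GoldenStructure g) (hG : G.IsParallel nabla)
    {f : M → N} {V : ∀ x : M, TangentSpace 𝓘(ℝ, E) (f x)} {x : M}
    (hf : MDifferentiableAt 𝓘(ℝ, F) 𝓘(ℝ, E) f x)
    (hV : MDifferentiableAt 𝓘(ℝ, F) 𝓘(ℝ, E).tangent
      (fun y ↦ (⟨f y, V y⟩ : TangentBundle 𝓘(ℝ, E) N)) x) (v : TangentSpace 𝓘(ℝ, F) x) :
    covAlong nabla f (fun y ↦ G.P (f y) (V y)) x v = G.P (f x) (covAlong nabla f V x v) := by
  obtain ⟨A, hA, hAP⟩ := G.exists_coord_endomorphism (f x)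
  have h0 := FiberBundle.mem_baseSet_trivializationAt E
    (TangentSpace 𝓘(ℝ, E) : N → Type _) (f x)
  have hc : MDifferentiableAt 𝓘(ℝ, F) 𝓘(ℝ, E) (coordAlong f V x) x :=
    ((mdifferentiableAt_totalSpace _ _).1 hV).2
  set c := coordAlong f V x with hcdef
  have hPc : coordAlong f (fun y ↦ G.P (f y) (V y)) x =ᶠ[𝓝 x] fun y ↦ A (f y) (c y) := by
    filter_upwards [hf.continuousAt.eventually (eventually_mem_baseSet (E := E) (f x))] with y hy
    exact (hAP _ hy).1 _
  have hAf : MDifferentiableAt 𝓘(ℝ, F) 𝓘(ℝ, E →L[ℝ] E) (fun y ↦ A (f y)) x := hA.comp x hf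
  have hd := (mdifferentiableAt_clm_apply hAf hc).2 v
  have hd' := mdifferentiableAt_clm_apply hA (mdifferentiableAt_const (c := c x))
  have hX : DiffAt E (coordField (f x) fun _ ↦ c x) (f x) :=
    diffAt_coordField mdifferentiableAt_const
  -- The field `P (coordField c)` with `c` frozen has coordinates `A q (c x)`. Computing its
  -- derivative both by the coordinate formula and by parallelism expresses the derivative of `A`
  -- through `nabla`; this absorbs the extra term of the product rule for `A (f y) (c y)`.
  have key := nabla_coordField nabla hd'.1 (diff f x v)
  have hcong : ∀ᶠ q in 𝓝 (f x), coordField (f x) (fun q ↦ A q (c x)) q =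
      G.P q (coordField (f x) (fun _ ↦ c x) q) := by
    filter_upwards [eventually_mem_baseSet (E := E) (f x)] with q hq
    exact ((hAP q hq).2 _).symm
  have hY := diffAt_coordField (p₀ := f x) hd'.1
  rw [nabla_congr nabla hY (hY.congr_of_eventuallyEq (hcong.mono fun q hq ↦ congrArg (TotalSpace.mk q) hq.symm)) hcong,
    hG _ _ _ hX] at key
  have hcomp : mvfderiv 𝓘(ℝ, F) (fun y ↦ A (f y)) x v = mvfderiv 𝓘(ℝ, E) A (f x) (diff f x v) :=
    congrArg (· v) (mfderiv_comp x hA hf)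
  have hzero : mvfderiv 𝓘(ℝ, E) (fun _ : N ↦ c x) (f x) (diff f x v) = 0 := by
    rw [mvfderiv, mfderiv_const]
    rfl
  have hPd : mvfderiv 𝓘(ℝ, F) (coordAlong f (fun y ↦ G.P (f y) (V y)) x) x v =
      mvfderiv 𝓘(ℝ, F) (fun y ↦ A (f y) (c y)) x v := 
    DFunLike.congr_fun (F := F →L[ℝ] E) hPc.mfderiv_eq v
  rw [covAlong_eq_coordField, covAlong_eq_coordField, map_add, (hAP _ h0).2, ← hcdef, key,
    hPc.self_of_nhds, hPd, hd, hd'.2, hcomp, hzero]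
  simp only [map_add, map_zero, add_zero]
  abel

end Parallel

/-! ### The Lie bracket as a commutator of derivatives -/

section Bracket

variable {E : Type*} [NormedAddCommGroup E] [NormedSpace ℝ E]
  {F : Type*} [NormedAddCommGroup F] [NormedSpace ℝ F]
  {M : Type*} [TopologicalSpace M] [ChartedSpace F M]

theorem contDiffAt_comp_extChartAt_symm {Φ : M → E} {x : M} {n : ℕ∞ω}
    (hΦ : ContMDiffAt 𝓘(ℝ, F) 𝓘(ℝ, E) n Φ x) :
    ContDiffAt ℝ n (Φ ∘ (extChartAt 𝓘(ℝ, F) x).symm) (extChartAt 𝓘(ℝ, F) x x) := by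
  have h := (contMDiffAt_iff.1 hΦ).2
  rw [modelWithCornersSelf_coe, Set.range_id] at h
  exact h.contDiffAt Filter.univ_mem

variable [IsManifold 𝓘(ℝ, F) ∞ M]

/-- The pullback is defined through the inverse of the differential of the inverse chart, and that
inverse is the differential of the chart. -/
theorem mpullbackWithin_extChartAt_symm_apply (W : ∀ y : M, TangentSpace 𝓘(ℝ, F) y) {x : M} {e : F}
    (he : e ∈ (extChartAt 𝓘(ℝ, F) x).target) :
    VectorField.mpullbackWithin 𝓘(ℝ, F) 𝓘(ℝ, F) (extChartAt 𝓘(ℝ, F) x).symm W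
        (Set.range 𝓘(ℝ, F)) e =
      mvfderiv 𝓘(ℝ, F) (extChartAt 𝓘(ℝ, F) x) ((extChartAt 𝓘(ℝ, F) x).symm e)
        (W ((extChartAt 𝓘(ℝ, F) x).symm e)) := by
  have h := ContinuousLinearMap.inverse_eq
    (mfderivWithin_extChartAt_symm_comp_mfderiv_extChartAt he)
    (mfderiv_extChartAt_comp_mfderivWithin_extChartAt_symm he)
  rw [VectorField.mpullbackWithin_apply]
  exact DFunLike.congr_fun (F := TangentSpace 𝓘(ℝ, F) ((extChartAt 𝓘(ℝ, F) x).symm e) →L[ℝ] F) h _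

/-- The chain rule through the chart at `x`. It is needed on a neighbourhood, not just at `x`,
because both sides are differentiated once more. -/
theorem mvfderiv_eq_comp_extChartAt {Φ : M → E} {x : M}
    (hΦ : ContMDiffAt 𝓘(ℝ, F) 𝓘(ℝ, E) 1 Φ x) :
    ∀ᶠ y in 𝓝 x, ∀ v : TangentSpace 𝓘(ℝ, F) y, mvfderiv 𝓘(ℝ, F) Φ y v =
      fderiv ℝ (Φ ∘ (extChartAt 𝓘(ℝ, F) x).symm) (extChartAt 𝓘(ℝ, F) x y)
        (mvfderiv 𝓘(ℝ, F) (extChartAt 𝓘(ℝ, F) x) y v) := by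
  have h1 := (contDiffAt_comp_extChartAt_symm hΦ).eventually (by simp)
  filter_upwards [(continuousAt_extChartAt (I := 𝓘(ℝ, F)) x).eventually h1,
    eventually_eventually_nhds.2 (extChartAt_source_mem_nhds (I := 𝓘(ℝ, F)) x)] with y hy hys v
  have hφ : MDifferentiableAt 𝓘(ℝ, F) 𝓘(ℝ, F) (extChartAt 𝓘(ℝ, F) x) y :=
    mdifferentiableAt_extChartAt (by
      have h : y ∈ (extChartAt 𝓘(ℝ, F) x).source := hys.self_of_nhds
      rwa [extChartAt_source] at h)
  have he : Φ =ᶠ[𝓝 y] (Φ ∘ (extChartAt 𝓘(ℝ, F) x).symm) ∘ extChartAt 𝓘(ℝ, F) x := by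
    filter_upwards [hys] with z hz
    simp only [Function.comp_apply]
    rw [(extChartAt 𝓘(ℝ, F) x).left_inv hz]
  have hd : HasMFDerivAt 𝓘(ℝ, F) 𝓘(ℝ, E)
      ((Φ ∘ (extChartAt 𝓘(ℝ, F) x).symm) ∘ extChartAt 𝓘(ℝ, F) x) y _ :=
    (hy.differentiableAt one_ne_zero).hasFDerivAt.hasMFDerivAt.comp y hφ.hasMFDerivAt
  exact DFunLike.congr_fun (F := TangentSpace 𝓘(ℝ, F) y →L[ℝ] E)
    (hd.congr_of_eventuallyEq he).mfderiv v

theorem differentiableAt_mpullbackWithin_extChartAt_symm [CompleteSpace F] {x : M}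
    {W : ∀ y : M, TangentSpace 𝓘(ℝ, F) y} (hW : DiffAt F W x) :
    DifferentiableAt ℝ (VectorField.mpullbackWithin 𝓘(ℝ, F) 𝓘(ℝ, F) (extChartAt 𝓘(ℝ, F) x).symm W
      (Set.range 𝓘(ℝ, F))) (extChartAt 𝓘(ℝ, F) x x) := by
  have h := MDifferentiableWithinAt.differentiableWithinAt_mpullbackWithin_vectorField
    (s := Set.univ) (mdifferentiableWithinAt_univ.2 hW)
  exact h.differentiableAt (by simp)

theorem mvfderiv_mvfderiv_apply [CompleteSpace F] {Φ : M → E} {x : M}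
    (hΦ : ContMDiffAt 𝓘(ℝ, F) 𝓘(ℝ, E) 2 Φ x) {W : ∀ y : M, TangentSpace 𝓘(ℝ, F) y}
    (hW : DiffAt F W x) (v : TangentSpace 𝓘(ℝ, F) x) :
    mvfderiv 𝓘(ℝ, F) (fun y ↦ mvfderiv 𝓘(ℝ, F) Φ y (W y)) x v =
      fderiv ℝ (fun e ↦ fderiv ℝ (Φ ∘ (extChartAt 𝓘(ℝ, F) x).symm) e
        (VectorField.mpullbackWithin 𝓘(ℝ, F) 𝓘(ℝ, F) (extChartAt 𝓘(ℝ, F) x).symm W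
          (Set.range 𝓘(ℝ, F)) e)) (extChartAt 𝓘(ℝ, F) x x)
        (mvfderiv 𝓘(ℝ, F) (extChartAt 𝓘(ℝ, F) x) x v) := by
  set φ := extChartAt 𝓘(ℝ, F) x with hφdef
  have hH : DifferentiableAt ℝ (fun e ↦ fderiv ℝ (Φ ∘ φ.symm) e
      (VectorField.mpullbackWithin 𝓘(ℝ, F) 𝓘(ℝ, F) φ.symm W (Set.range 𝓘(ℝ, F)) e)) (φ x) :=
    (((contDiffAt_comp_extChartAt_symm hΦ).fderiv_right (m := 1) le_rfl).differentiableAt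
      one_ne_zero).clm_apply (differentiableAt_mpullbackWithin_extChartAt_symm hW)
  have he : (fun y ↦ mvfderiv 𝓘(ℝ, F) Φ y (W y)) =ᶠ[𝓝 x]
      (fun e ↦ fderiv ℝ (Φ ∘ φ.symm) e
        (VectorField.mpullbackWithin 𝓘(ℝ, F) 𝓘(ℝ, F) φ.symm W (Set.range 𝓘(ℝ, F)) e)) ∘ φ := by
    filter_upwards [mvfderiv_eq_comp_extChartAt (hΦ.of_le one_le_two),
      extChartAt_source_mem_nhds (I := 𝓘(ℝ, F)) x] with y hy hys
    rw [hy, Function.comp_apply, mpullbackWithin_extChartAt_symm_apply W (φ.map_source hys)]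
    exact congrArg (fderiv ℝ (Φ ∘ φ.symm) (φ y))
      (congrArg (fun z ↦ mvfderiv 𝓘(ℝ, F) φ z (W z)) (φ.left_inv hys)).symm
  have hd : HasMFDerivAt 𝓘(ℝ, F) 𝓘(ℝ, E)
      ((fun e ↦ fderiv ℝ (Φ ∘ φ.symm) e
        (VectorField.mpullbackWithin 𝓘(ℝ, F) 𝓘(ℝ, F) φ.symm W (Set.range 𝓘(ℝ, F)) e)) ∘ φ) x _ :=
    hH.hasFDerivAt.hasMFDerivAt.comp x
      (mdifferentiableAt_extChartAt (mem_chart_source F x)).hasMFDerivAt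
  exact DFunLike.congr_fun (F := TangentSpace 𝓘(ℝ, F) x →L[ℝ] E)
    (hd.congr_of_eventuallyEq he).mfderiv v

/-- The differential of a vector-valued map along `[U, W]` is the commutator of the directional
derivatives. -/
theorem mvfderiv_mlieBracket [CompleteSpace F] {Φ : M → E} {x : M}
    (hΦ : ContMDiffAt 𝓘(ℝ, F) 𝓘(ℝ, E) 2 Φ x) {U W : ∀ y : M, TangentSpace 𝓘(ℝ, F) y}
    (hU : DiffAt F U x) (hW : DiffAt F W x) :
    mvfderiv 𝓘(ℝ, F) Φ x (VectorField.mlieBracket 𝓘(ℝ, F) U W x) =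
      mvfderiv 𝓘(ℝ, F) (fun y ↦ mvfderiv 𝓘(ℝ, F) Φ y (W y)) x (U x) -
      mvfderiv 𝓘(ℝ, F) (fun y ↦ mvfderiv 𝓘(ℝ, F) Φ y (U y)) x (W x) := by
  have hself (Z : ∀ y : M, TangentSpace 𝓘(ℝ, F) y) :
      VectorField.mpullbackWithin 𝓘(ℝ, F) 𝓘(ℝ, F) (extChartAt 𝓘(ℝ, F) x).symm Z
        (Set.range 𝓘(ℝ, F)) (extChartAt 𝓘(ℝ, F) x x) =
      mvfderiv 𝓘(ℝ, F) (extChartAt 𝓘(ℝ, F) x) x (Z x) :=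
    (mpullbackWithin_extChartAt_symm_apply Z (mem_extChartAt_target x)).trans
      (congrArg (fun z ↦ mvfderiv 𝓘(ℝ, F) (extChartAt 𝓘(ℝ, F) x) z (Z z)) (extChartAt_to_inv x))
  have hb : mvfderiv 𝓘(ℝ, F) (extChartAt 𝓘(ℝ, F) x) x (VectorField.mlieBracket 𝓘(ℝ, F) U W x) =
      VectorField.lieBracket ℝ
        (VectorField.mpullbackWithin 𝓘(ℝ, F) 𝓘(ℝ, F) (extChartAt 𝓘(ℝ, F) x).symm U
          (Set.range 𝓘(ℝ, F)))
        (VectorField.mpullbackWithin 𝓘(ℝ, F) 𝓘(ℝ, F) (extChartAt 𝓘(ℝ, F) x).symm W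
          (Set.range 𝓘(ℝ, F))) (extChartAt 𝓘(ℝ, F) x x) := by
    rw [← VectorField.mlieBracketWithin_univ, VectorField.mlieBracketWithin_apply,
      Set.preimage_univ, Set.univ_inter]
    -- The manifold bracket is the bracket in the chart followed by the inverse differential of the
    -- chart, which cancels here.
    have hi := (isInvertible_mfderiv_extChartAt (I := 𝓘(ℝ, F))
      (mem_extChartAt_source x)).self_comp_inverse
    refine (DFunLike.congr_fun (F := F →L[ℝ] F) hi _).trans ?_
    rw [modelWithCornersSelf_coe, Set.range_id]
    exact congrFun VectorField.lieBracketWithin_univ _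
  -- In the chart this is the vector space formula, which rests on the symmetry of the second
  -- derivative of a `C²` map.
  rw [(mvfderiv_eq_comp_extChartAt (hΦ.of_le one_le_two)).self_of_nhds, hb,
    VectorField.fderiv_apply_lieBracket (contDiffAt_comp_extChartAt_symm hΦ) (by simp)
      (differentiableAt_mpullbackWithin_extChartAt_symm hW)
      (differentiableAt_mpullbackWithin_extChartAt_symm hU),
    mvfderiv_mvfderiv_apply hΦ hW, mvfderiv_mvfderiv_apply hΦ hU, hself, hself]

end Bracket

/-! ### Torsion-freeness along a map -/

section Torsion

variable {E : Type*} [NormedAddCommGroup E] [NormedSpace ℝ E]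
  {N : Type*} [TopologicalSpace N] [ChartedSpace E N] [IsManifold 𝓘(ℝ, E) ∞ N]

theorem trivializationAt_apply_eq_mvfderiv {p₀ q : N}
    (hq : q ∈ (trivializationAt E (TangentSpace 𝓘(ℝ, E) : N → Type _) p₀).baseSet)
    (v : TangentSpace 𝓘(ℝ, E) q) :
    (trivializationAt E (TangentSpace 𝓘(ℝ, E) : N → Type _) p₀ ⟨q, v⟩).2 =
      mvfderiv 𝓘(ℝ, E) (extChartAt 𝓘(ℝ, E) p₀) q v := by
  have h := TangentBundle.continuousLinearMapAt_trivializationAt (I := 𝓘(ℝ, E)) (x₀ := p₀) (x := q) hq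
  refine Eq.trans ?_ (DFunLike.congr_fun (F := TangentSpace 𝓘(ℝ, E) q →L[ℝ] E) h v)
  rw [Trivialization.continuousLinearMapAt_apply, Trivialization.coe_linearMapAt_of_mem _ hq]

theorem mvfderiv_extChartAt_coordField {p₀ q : N}
    (hq : q ∈ (trivializationAt E (TangentSpace 𝓘(ℝ, E) : N → Type _) p₀).baseSet) (φ : N → E) :
    mvfderiv 𝓘(ℝ, E) (extChartAt 𝓘(ℝ, E) p₀) q (coordField p₀ φ q) = φ q := by
  rw [← trivializationAt_apply_eq_mvfderiv hq, coordField_apply _ hq,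
    Trivialization.apply_mk_symm _ hq]

theorem symmL_mvfderiv_extChartAt {p₀ q : N}
    (hq : q ∈ (trivializationAt E (TangentSpace 𝓘(ℝ, E) : N → Type _) p₀).baseSet)
    (v : TangentSpace 𝓘(ℝ, E) q) :
    (trivializationAt E (TangentSpace 𝓘(ℝ, E) : N → Type _) p₀).symmL ℝ q
      (mvfderiv 𝓘(ℝ, E) (extChartAt 𝓘(ℝ, E) p₀) q v) = v := by
  rw [← trivializationAt_apply_eq_mvfderiv hq, Trivialization.symmL_apply _ hq,
    Trivialization.symm_apply_apply_mk _ hq]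

/-- Coordinate fields commute: the differential of the chart sends them to constants, so by
`mvfderiv_mlieBracket` it kills their bracket, and it is injective. -/
theorem mlieBracket_coordField_const [CompleteSpace E] (p₀ : N) (a b : E) :
    VectorField.mlieBracket 𝓘(ℝ, E) (coordField p₀ fun _ ↦ a) (coordField p₀ fun _ ↦ b) p₀ = 0 := by
  have h0 := FiberBundle.mem_baseSet_trivializationAt E (TangentSpace 𝓘(ℝ, E) : N → Type _) p₀
  have hconst (c : E) (v : TangentSpace 𝓘(ℝ, E) p₀) : mvfderiv 𝓘(ℝ, E) (fun q ↦
      mvfderiv 𝓘(ℝ, E) (extChartAt 𝓘(ℝ, E) p₀) q (coordField p₀ (fun _ ↦ c) q)) p₀ v = 0 := by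
    have he : (fun q ↦ mvfderiv 𝓘(ℝ, E) (extChartAt 𝓘(ℝ, E) p₀) q (coordField p₀ (fun _ ↦ c) q))
        =ᶠ[𝓝 p₀] fun _ ↦ c := by
      filter_upwards [eventually_mem_baseSet (E := E) p₀] with q hq
      exact mvfderiv_extChartAt_coordField hq _
    exact DFunLike.congr_fun (F := E →L[ℝ] E)
      ((hasMFDerivAt_const c p₀).congr_of_eventuallyEq he).mfderiv v
  have h := mvfderiv_mlieBracket (contMDiffAt_extChartAt (I := 𝓘(ℝ, E)) (x := p₀) (n := 2))
    (diffAt_coordField (p₀ := p₀) (φ := fun _ ↦ a) mdifferentiableAt_const)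
    (diffAt_coordField (p₀ := p₀) (φ := fun _ ↦ b) mdifferentiableAt_const)
  rw [hconst, hconst, sub_zero] at h
  rw [← symmL_mvfderiv_extChartAt h0 (VectorField.mlieBracket _ _ _ p₀), h, map_zero]

variable {F : Type*} [NormedAddCommGroup F] [NormedSpace ℝ F]
  {M : Type*} [TopologicalSpace M] [ChartedSpace F M] [IsManifold 𝓘(ℝ, F) ∞ M]

/-- The pullback of a torsion-free connection is torsion-free:
`∇_U (df W) - ∇_W (df U) = df [U, W]`. -/
theorem covAlong_sub_covAlong [FiniteDimensional ℝ E] [CompleteSpace F]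
    {g : SemiRiemannianMetric E N}
    {nabla : CovariantDerivative 𝓘(ℝ, E) E (TangentSpace 𝓘(ℝ, E) : N → Type _)}
    (hnabla : IsLeviCivita g nabla) {f : M → N} (hf : ContMDiff 𝓘(ℝ, F) 𝓘(ℝ, E) 2 f) {x : M}
    {U W : ∀ y : M, TangentSpace 𝓘(ℝ, F) y} (hU : DiffAt F U x) (hW : DiffAt F W x) :
    covAlong nabla f (fun y ↦ diff f y (W y)) x (U x) -
      covAlong nabla f (fun y ↦ diff f y (U y)) x (W x) =
      diff (E := E) f x (VectorField.mlieBracket 𝓘(ℝ, F) U W x) := by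
  have : CompleteSpace E := FiniteDimensional.complete ℝ E
  have h0 := FiberBundle.mem_baseSet_trivializationAt E
    (TangentSpace 𝓘(ℝ, E) : N → Type _) (f x)
  have hΦ : ContMDiffAt 𝓘(ℝ, F) 𝓘(ℝ, E) 2 (extChartAt 𝓘(ℝ, E) (f x) ∘ f) x :=
    contMDiffAt_extChartAt.comp x (hf x)
  have hcomp : ∀ᶠ y in 𝓝 x, ∀ v : TangentSpace 𝓘(ℝ, F) y,
      mvfderiv 𝓘(ℝ, E) (extChartAt 𝓘(ℝ, E) (f x)) (f y) (diff f y v) =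
        mvfderiv 𝓘(ℝ, F) (extChartAt 𝓘(ℝ, E) (f x) ∘ f) y v := by
    filter_upwards [hf.continuous.continuousAt.eventually (eventually_mem_baseSet (E := E) (f x))] with y hy v
    exact (DFunLike.congr_fun (F := F →L[ℝ] E)
      (mfderiv_comp y (mdifferentiableAt_extChartAt hy) (hf.mdifferentiable two_ne_zero y)) v).symm
  -- The coordinates of `df Z` are the derivative along `Z` of `f` read in the chart at `f x`, so
  -- the commutator formula applies to them.
  have hcoord (Z : ∀ y : M, TangentSpace 𝓘(ℝ, F) y) : coordAlong f (fun y ↦ diff (E := E) f y (Z y)) x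
      =ᶠ[𝓝 x] fun y ↦ mvfderiv 𝓘(ℝ, F) (extChartAt 𝓘(ℝ, E) (f x) ∘ f) y (Z y) := by
    filter_upwards [hf.continuous.continuousAt.eventually (eventually_mem_baseSet (E := E) (f x)),
      hcomp] with y hy hc
    rw [← hc]
    exact trivializationAt_apply_eq_mvfderiv hy _
  have hd (Z : ∀ y : M, TangentSpace 𝓘(ℝ, F) y) (v : TangentSpace 𝓘(ℝ, F) x) :
      mvfderiv 𝓘(ℝ, F) (coordAlong f (fun y ↦ diff (E := E) f y (Z y)) x) x v =
      mvfderiv 𝓘(ℝ, F) (fun y ↦ mvfderiv 𝓘(ℝ, F) (extChartAt 𝓘(ℝ, E) (f x) ∘ f) y (Z y)) x v :=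
    DFunLike.congr_fun (F := F →L[ℝ] E) (hcoord Z).mfderiv_eq v
  have hval (Z : ∀ y : M, TangentSpace 𝓘(ℝ, F) y) :
      coordField (f x) (fun _ ↦ coordAlong f (fun y ↦ diff (E := E) f y (Z y)) x x) (f x) =
        diff (E := E) f x (Z x) := by
    rw [coordField_apply _ h0]
    exact Trivialization.symm_apply_apply_mk _ h0 _
  -- The frozen fields take the values `df U` and `df W` at `f x` and commute there, so their two
  -- `nabla` terms cancel in the difference.
  have ht := hnabla.torsion_free
    (coordField (f x) fun _ ↦ coordAlong f (fun y ↦ diff (E := E) f y (U y)) x x)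
    (coordField (f x) fun _ ↦ coordAlong f (fun y ↦ diff (E := E) f y (W y)) x x) (f x)
    (diffAt_coordField mdifferentiableAt_const) (diffAt_coordField mdifferentiableAt_const)
  rw [mlieBracket_coordField_const, hval, hval] at ht
  rw [covAlong_eq_coordField, covAlong_eq_coordField, add_sub_add_comm, ht, add_zero, ← map_sub,
    hd, hd, ← mvfderiv_mlieBracket hΦ hU hW, ← hcomp.self_of_nhds, symmL_mvfderiv_extChartAt h0]

end Torsion

/-! ### The `ltr`-component and integrability of the screen -/

section Main

variable {E : Type*} [NormedAddCommGroup E] [NormedSpace ℝ E]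
  {N : Type*} [TopologicalSpace N] [ChartedSpace E N] [IsManifold 𝓘(ℝ, E) ∞ N]
  {F : Type*} [NormedAddCommGroup F] [NormedSpace ℝ F]
  {M : Type*} [TopologicalSpace M] [ChartedSpace F M] [IsManifold 𝓘(ℝ, F) ∞ M]
  {g : SemiRiemannianMetric E N} {f : M → N}

namespace LightlikeSubmanifold

theorem screenProj_of_mem (L : LightlikeSubmanifold (F := F) g f) {x : M}
    {v : TangentSpace 𝓘(ℝ, F) x} (hv : v ∈ L.screen x) : L.screenProj x v = v :=
  congrArg Subtype.val (Submodule.projectionOnto_apply_left (L.screen_isCompl x) ⟨v, hv⟩)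

/-- On a radical transversal submanifold, `P v` has no `ltr(TM)`-component exactly when `v` lies in
the screen distribution. -/
theorem ltrPart_P_diff_eq_zero_iff (L : LightlikeSubmanifold (F := F) g f)
    (G : GoldenStructure g) (hL : L.IsRadicalTransversal G) {x : M}
    (v : TangentSpace 𝓘(ℝ, F) x) :
    L.ltrPart x (G.P (f x) (diff f x v)) = 0 ↔ v ∈ L.screen x := by
  have hker (u : TangentSpace 𝓘(ℝ, E) (f x)) :
      L.ltrPart x u = 0 ↔ u ∈ LinearMap.range (diff (F := F) f x) ⊔ L.strans x :=
    Submodule.projectionOnto_apply_eq_zero_iff _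
  have hscreen {s : TangentSpace 𝓘(ℝ, F) x} (hs : s ∈ L.screen x) :
      L.ltrPart x (G.P (f x) (diff f x s)) = 0 := by
    rw [hker]
    have hm : G.P (f x) (diff f x s) ∈ (L.screen x).map (diff f x) := by
      rw [← hL.map_screen x]
      exact ⟨_, ⟨s, hs, rfl⟩, rfl⟩
    obtain ⟨u, -, hu⟩ := hm
    exact Submodule.mem_sup_left ⟨u, hu⟩
  refine ⟨fun h ↦ ?_, hscreen⟩
  obtain ⟨s, hs, r, hr, rfl⟩ := Submodule.mem_sup.1
    ((L.screen_isCompl x).sup_eq_top.symm ▸ Submodule.mem_top (x := v))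
  rw [map_add, map_add, map_add, hscreen hs, zero_add, hker] at h
  have hm : G.P (f x) (diff f x r) ∈ L.ltr x := by
    rw [← hL.map_radical x]
    exact ⟨_, ⟨r, hr, rfl⟩, rfl⟩
  -- The image of the radical part lies both in `ltr` and in its complement.
  have h0 : G.P (f x) (diff f x r) = 0 := Submodule.disjoint_def.1 (L.ltr_isCompl x).disjoint _ h hm
  -- If `P u = 0`, then `P² = P + I` gives `u = 0`.
  have h1 := G.golden (f x) (diff f x r)
  rw [h0, map_zero, zero_add] at h1
  have hr0 : r = 0 := L.immersion x (by rw [← h1, map_zero])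
  rwa [hr0, add_zero]

/-- Moves `P` outside the derivative, so that two such terms can be subtracted under the linear maps
`ltrPart` and `P`. -/
theorem hl_goldenS [FiniteDimensional ℝ E]
    {nabla : CovariantDerivative 𝓘(ℝ, E) E (TangentSpace 𝓘(ℝ, E) : N → Type _)}
    {G : GoldenStructure g} (hG : G.IsParallel nabla) (L : LightlikeSubmanifold (F := F) g f)
    (hL : L.IsRadicalTransversal G) (U : ∀ x : M, TangentSpace 𝓘(ℝ, F) x)
    {W : ∀ x : M, TangentSpace 𝓘(ℝ, F) x} (hW : IsSection L.screen W) (x : M) :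
    L.hl nabla U (L.goldenS G W) x =
      L.ltrPart x (G.P (f x) (covAlong nabla f (fun y ↦ diff f y (W y)) x (U x))) := by
  have hV : MDifferentiableAt 𝓘(ℝ, F) 𝓘(ℝ, E).tangent
      (fun y ↦ (⟨f y, diff f y (W y)⟩ : TangentBundle 𝓘(ℝ, E) N)) x :=
    ((L.smooth.contMDiff_tangentMap (m := ∞) (by simp)).comp hW.1).mdifferentiableAt (by simp)
  have hfun : (fun y ↦ diff f y (L.goldenS G W y)) = fun y ↦ G.P (f y) (diff f y (W y)) := by
    funext y
    rw [L.diff_goldenS G hL, L.screenProj_of_mem (hW.2 y)]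
  rw [hl, hfun, covAlong_parallel G hG (L.smooth.mdifferentiable (by simp) x) hV]

end LightlikeSubmanifold

end Main

end GoldenLightlike

theorem mainTheorem4
    {E : Type*} [NormedAddCommGroup E] [NormedSpace ℝ E] [FiniteDimensional ℝ E]
    {N : Type*} [TopologicalSpace N] [T2Space N] [SecondCountableTopology N]
    [ChartedSpace E N] [IsManifold 𝓘(ℝ, E) ∞ N]
    {F : Type*} [NormedAddCommGroup F] [NormedSpace ℝ F] [FiniteDimensional ℝ F]
    {M : Type*} [TopologicalSpace M] [T2Space M] [SecondCountableTopology M]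
    [ChartedSpace F M] [IsManifold 𝓘(ℝ, F) ∞ M]
    (g : GoldenLightlike.SemiRiemannianMetric E N)
    (nabla : CovariantDerivative 𝓘(ℝ, E) E (TangentSpace 𝓘(ℝ, E) : N → Type _))
    (hnabla : GoldenLightlike.IsLeviCivita g nabla)
    (G : GoldenLightlike.GoldenStructure g) (hG : G.IsParallel nabla)
    (f : M → N) (L : GoldenLightlike.LightlikeSubmanifold (F := F) g f)
    (hL : L.IsRadicalTransversal G) :
    GoldenLightlike.IsIntegrable L.screen ↔
      ∀ W U : ∀ x : M, TangentSpace 𝓘(ℝ, F) x,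
        GoldenLightlike.IsSection L.screen W → GoldenLightlike.IsSection L.screen U →
        ∀ x : M, L.hl nabla U (L.goldenS G W) x = L.hl nabla W (L.goldenS G U) x := by
  -- The equivalence already holds for each pair of sections at each point.
  have key (U W : ∀ x : M, TangentSpace 𝓘(ℝ, F) x) (hU : GoldenLightlike.IsSection L.screen U)
      (hW : GoldenLightlike.IsSection L.screen W) (x : M) :
      VectorField.mlieBracket 𝓘(ℝ, F) U W x ∈ L.screen x ↔
        L.hl nabla U (L.goldenS G W) x = L.hl nabla W (L.goldenS G U) x := by
    have : CompleteSpace F := FiniteDimensional.complete ℝ F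
    rw [L.hl_goldenS hG hL U hW, L.hl_goldenS hG hL W hU, ← sub_eq_zero, ← map_sub, ← map_sub,
      GoldenLightlike.covAlong_sub_covAlong hnabla (L.smooth.of_le ENat.LEInfty.out)
        (hU.1.mdifferentiable (by simp) x) (hW.1.mdifferentiable (by simp) x),
      L.ltrPart_P_diff_eq_zero_iff G hL]
  exact ⟨fun h W U hW hU x ↦ (key U W hU hW x).1 (h U W hU hW x),
    fun h U W hU hW x ↦ (key U W hU hW x).2 (h W U hW hU x)⟩
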